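/- All spaces are Tychonoff. Let $C_p(X)$ denote the space of continuous real-valued functions on $X$ with the topology of pointwise convergence, and $C_p^b(X)$ its subspace of bounded functions. A space is called a $\kappa$-space if it is homeomorphic to a closed subspace of $C_p(L)$ for some locally compact Hausdorff space $L$; the $\kappa$-completion $\kappa X$ of $X$ is the intersection of all subspaces of the Stone–Čech compactification $\beta X$ which contain $X$ and are $\kappa$-spaces. For $X\subseteq Y\subseteq\beta X$, we say that $C_p(Y)$ and $C_p(X)$ (respectively, $C_p^b(Y)$ and $C_p^b(X)$) have the same compact subsets if, for the restriction map $r(f)=f|_X$, the assignment $K\mapsto r(K)$ is a bijection from the family of all compact subsets of $C_p(Y)$ (respectively, $C_p^b(Y)$) onto the family of all compact subsets of $C_p(X)$ (respectively, $C_p^b(X)$). Theorem. Let $X$ be a Tychonoff space. For every $Y$ with $X\subseteq Y\subseteq\beta X$, the following assertions are equivalent: (i) $C_p(Y)$ and $C_p(X)$ have the same compact subsets; (ii) $C_p^b(Y)$ and $C_p^b(X)$ have the same compact subsets; (iii) $Y\subseteq\kappa X$. Consequently, $\kappa X$ is the largest subspace $Y$ of $\beta X$ containing $X$ for which $C_p(Y)$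 and $C_p(X)$ have the same compact subsets. -/

import Mathlib

universe u

open Set Topology

/-- The space of continuous real-valued functions on `X` with the topology of pointwise
convergence, i.e. the subspace topology from the product `X → ℝ`. -/
abbrev Cp (X : Type*) [TopologicalSpace X] : Type _ :=
  {f : X → ℝ // Continuous f}

/-- The subspace of `Cp X` consisting of the bounded functions. -/
abbrev Cpb (X : Type*) [TopologicalSpace X] : Type _ :=
  {f : Cp X // ∃ M : ℝ, ∀ x, |f.1 x| ≤ M}

/-- A space is a `κ`-space if it is homeomorphic to a closed subspace of `Cp Y` for some
locally compact Hausdorff space `Y`. (Such a space is automatically Tychonoff.) -/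
def IsKappaSpace (Z : Type u) [TopologicalSpace Z] : Prop :=
  ∃ (Y : Type u) (_ : TopologicalSpace Y) (_ : T2Space Y) (_ : LocallyCompactSpace Y)
    (f : Z → Cp Y), IsClosedEmbedding f

/-- The `κ`-completion of `X`: the intersection of all subspaces of `βX` which contain `X`
and are `κ`-spaces. -/
def kappaCompletion (X : Type u) [TopologicalSpace X] : Set (StoneCech X) :=
  ⋂₀ {Z : Set (StoneCech X) | range (stoneCechUnit : X → StoneCech X) ⊆ Z ∧ IsKappaSpace Z}

section Restriction

variable {X : Type*} [TopologicalSpace X] {Y : Set (StoneCech X)}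

/-- The restriction map `Cp Y → Cp X`, for `X ⊆ Y ⊆ βX`. -/
def Cp.restrict (h : range (stoneCechUnit : X → StoneCech X) ⊆ Y) (f : Cp Y) : Cp X :=
  ⟨fun x => f.1 ⟨stoneCechUnit x, h (mem_range_self x)⟩,
    f.2.comp (continuous_stoneCechUnit.subtype_mk _)⟩

/-- The restriction map `Cpb Y → Cpb X`, for `X ⊆ Y ⊆ βX`. -/
def Cpb.restrict (h : range (stoneCechUnit : X → StoneCech X) ⊆ Y) (f : Cpb Y) : Cpb X :=
  ⟨Cp.restrict h f.1, f.2.imp fun _ hM _ => hM _⟩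

end Restriction

/-- `A` and `B` have the same compact subsets, when the points of `A` are identified with points
of `B` by means of `r`: taking images under `r` is a bijection from the compact subsets of `A`
onto the compact subsets of `B`. -/
def SameCompactSubsets {A B : Type*} [TopologicalSpace A] [TopologicalSpace B]
    (r : A → B) : Prop :=
  BijOn (fun K : Set A => r '' K) {K | IsCompact K} {L | IsCompact L}

open Filter

section SameCompactSubsets

variable {A B : Type*} [TopologicalSpace A] [TopologicalSpace B] {r : A → B}

/-! For compact `K ⊆ Cp X`, the points of `βX` where every member of `K` extends finitely, with
value continuous in the member, form a κ-space. It therefore contains `κX`, so `K` lifts to `Cp Y`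
whenever `Y ⊆ κX`. Conversely, let the κ-space `Z ⊇ X` be closed in `Cp L`. Lifting compact families
of bounded functions shows that at `y ∈ Y` the coordinate functions on `X` indexed by `L` have
finite limits, continuous on compact subsets of `L`, hence on `L`. The limit lies in `Cp L`, and
closedness forces `y ∈ Z`. -/

theorem SameCompactSubsets.injective (h : SameCompactSubsets r) : Function.Injective r := by
  intro a b hab
  have := h.injOn (isCompact_singleton (x := a)) (isCompact_singleton (x := b))
    (by simp only [image_singleton, hab])
  exact singleton_injective this

/-- Continuous families over a compact space lift along `r`. -/
theorem SameCompactSubsets.exists_lift [T2Space B] (h : SameCompactSubsets r)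
    (hr : Continuous r) {T : Type*} [TopologicalSpace T] [CompactSpace T] {G : T → B}
    (hG : Continuous G) : ∃ G' : T → A, Continuous G' ∧ ∀ t, r (G' t) = G t := by
  obtain ⟨K, hK, hKG⟩ := h.surjOn (isCompact_range hG)
  have hmem : ∀ t, ∃ a : K, r a = G t := fun t => by
    have : G t ∈ r '' K := by
      have hKG' : r '' K = range G := hKG
      rw [hKG']
      exact mem_range_self t
    obtain ⟨a, ha, hat⟩ := this
    exact ⟨⟨a, ha⟩, hat⟩
  choose s hs using hmem
  have : CompactSpace K := isCompact_iff_compactSpace.1 hK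
  -- Compactness of `K` makes the inverse of `r` on `r '' K` continuous.
  have hemb : IsClosedEmbedding (fun a : K => r a) :=
    (hr.comp continuous_subtype_val).isClosedEmbedding
      (h.injective.comp Subtype.val_injective)
  refine ⟨fun t => s t, continuous_subtype_val.comp ?_, hs⟩
  rw [hemb.isInducing.continuous_iff]
  simpa only [Function.comp_def, hs] using hG

/-- A continuous injection with continuous sections over compact sets induces a bijection of
compact sets. -/
theorem SameCompactSubsets.of_sections (hr : Continuous r) (hinj : Function.Injective r)
    (hs : ∀ L : Set B, IsCompact L → ∃ s : L → A, Continuous s ∧ ∀ b, r (s b) = b) :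
    SameCompactSubsets r := by
  refine ⟨fun K hK => IsCompact.image hK hr, (image_injective.2 hinj).injOn, fun L hL => ?_⟩
  obtain ⟨s, hsc, hsr⟩ := hs L hL
  have : CompactSpace L := isCompact_iff_compactSpace.1 hL
  refine ⟨range s, isCompact_range hsc, ?_⟩
  change r '' range s = L
  rw [← range_comp]
  simp [Function.comp_def, hsr]

end SameCompactSubsets

theorem Cp.continuous_eval {X : Type*} [TopologicalSpace X] (x : X) :
    Continuous fun f : Cp X => f.1 x :=
  (continuous_apply x).comp continuous_subtype_val

theorem Cp.continuous_iff {X T : Type*} [TopologicalSpace X] [TopologicalSpace T]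
    {G : T → Cp X} : Continuous G ↔ ∀ x, Continuous fun t => (G t).1 x := by
  rw [continuous_induced_rng, continuous_pi_iff]
  rfl

theorem Cp.tendsto_iff {X T : Type*} [TopologicalSpace X] {l : Filter T}
    {G : T → Cp X} {g : Cp X} :
    Tendsto G l (𝓝 g) ↔ ∀ x, Tendsto (fun t => (G t).1 x) l (𝓝 (g.1 x)) := by
  rw [tendsto_subtype_rng, tendsto_pi_nhds]

/-! ### Permanence properties of κ-spaces -/

section KappaSpace

theorem IsKappaSpace.of_isClosedEmbedding {Z W : Type u} [TopologicalSpace Z]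
    [TopologicalSpace W] (hW : IsKappaSpace W) {f : Z → W} (hf : IsClosedEmbedding f) :
    IsKappaSpace Z := by
  obtain ⟨L, tL, t2, lc, g, hg⟩ := hW
  exact ⟨L, tL, t2, lc, g ∘ f, hg.comp hf⟩

theorem isKappaSpace_Cp (L : Type u) [TopologicalSpace L] [T2Space L] [LocallyCompactSpace L] :
    IsKappaSpace (Cp L) :=
  ⟨L, inferInstance, inferInstance, inferInstance, id, IsClosedEmbedding.id⟩

/-- `Cp` turns disjoint sums into products. -/
def Cp.prodHomeomorph (L M : Type*) [TopologicalSpace L] [TopologicalSpace M] :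
    Cp L × Cp M ≃ₜ Cp (L ⊕ M) where
  toFun p := ⟨Sum.elim p.1.1 p.2.1, p.1.2.sumElim p.2.2⟩
  invFun g := (⟨fun l => g.1 (Sum.inl l), g.2.comp continuous_inl⟩,
    ⟨fun m => g.1 (Sum.inr m), g.2.comp continuous_inr⟩)
  left_inv _ := rfl
  right_inv g := by
    apply Subtype.ext
    funext x
    cases x <;> rfl
  continuous_toFun := by
    rw [Cp.continuous_iff]
    rintro (l | m)
    · exact (Cp.continuous_eval l).comp continuous_fst
    · exact (Cp.continuous_eval m).comp continuous_snd
  continuous_invFun := by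
    refine Continuous.prodMk ?_ ?_ <;> rw [Cp.continuous_iff] <;>
      exact fun x => Cp.continuous_eval _

instance locallyCompactSpace_sum {L M : Type*} [TopologicalSpace L] [TopologicalSpace M]
    [LocallyCompactSpace L] [LocallyCompactSpace M] : LocallyCompactSpace (L ⊕ M) where
  local_compact_nhds := by
    rintro (l | m) n hn
    · obtain ⟨K, hK, hKn, hKc⟩ := local_compact_nhds (continuous_inl.continuousAt hn)
      exact ⟨Sum.inl '' K, IsOpenEmbedding.inl.image_mem_nhds.2 hK, image_subset_iff.2 hKn,
        hKc.image continuous_inl⟩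
    · obtain ⟨K, hK, hKn, hKc⟩ := local_compact_nhds (continuous_inr.continuousAt hn)
      exact ⟨Sum.inr '' K, IsOpenEmbedding.inr.image_mem_nhds.2 hK, image_subset_iff.2 hKn,
        hKc.image continuous_inr⟩

theorem IsKappaSpace.prod {Z W : Type u} [TopologicalSpace Z] [TopologicalSpace W]
    (hZ : IsKappaSpace Z) (hW : IsKappaSpace W) : IsKappaSpace (Z × W) := by
  obtain ⟨L, tL, t2L, lcL, f, hf⟩ := hZ
  obtain ⟨M, tM, t2M, lcM, g, hg⟩ := hW
  refine (isKappaSpace_Cp (L ⊕ M)).of_isClosedEmbedding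
    ((Cp.prodHomeomorph L M).isClosedEmbedding.comp (f := Prod.map f g) ?_)
  exact ⟨hf.isEmbedding.prodMap hg.isEmbedding, by
    rw [range_prodMap]
    exact hf.isClosed_range.prod hg.isClosed_range⟩

/-- Evaluation embeds `B` in a power of `ℝ`, which is `Cp` of a discrete, hence locally compact,
index space. -/
theorem isKappaSpace_of_compactSpace (B : Type u) [TopologicalSpace B] [CompactSpace B]
    [T2Space B] : IsKappaSpace B := by
  let D : TopologicalSpace (Cp B) := ⊥
  have : @DiscreteTopology (Cp B) D := @DiscreteTopology.mk _ D rfl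
  let e : B → @Cp (Cp B) D := fun b => ⟨fun f => f.1 b, continuous_of_discreteTopology⟩
  refine ⟨Cp B, D, inferInstance, inferInstance, e, Continuous.isClosedEmbedding ?_ ?_⟩
  · rw [Cp.continuous_iff]
    exact fun f => f.2
  · intro a b hab
    by_contra hne
    obtain ⟨f, hfa, hfb, -⟩ := exists_continuous_zero_one_of_isClosed
      (isClosed_singleton (x := a)) (isClosed_singleton (x := b)) (by simpa using hne)
    have h := congrFun (congrArg Subtype.val hab) ⟨f, f.continuous⟩
    have h0 : f a = 0 := hfa rfl
    have h1 : f b = 1 := hfb rfl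
    have h' : f a = f b := h
    rw [h0, h1] at h'
    exact zero_ne_one h'

end KappaSpace

/-! ### Extending compact families of functions to subspaces of `βX` -/

section Completion

variable {X : Type u} [TopologicalSpace X]

/-- The extension of a continuous real function to the Stone–Čech compactification, with values
in the extended reals. -/
noncomputable def Cp.extend (f : Cp X) : StoneCech X → EReal :=
  stoneCechExtend (g := fun x => (f.1 x : EReal)) (continuous_coe_real_ereal.comp f.2)

theorem Cp.continuous_extend (f : Cp X) : Continuous f.extend :=
  continuous_stoneCechExtend _

theorem Cp.extend_unit (f : Cp X) (x : X) : f.extend (stoneCechUnit x) = f.1 x :=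
  congrFun (stoneCechExtend_extends (continuous_coe_real_ereal.comp f.2)) x

/-- The points of `βX` at which all members of `K` have finite values that depend continuously
on the member of `K`. -/
def finiteContinuousLocus (K : Set (Cp X)) : Set (StoneCech X) :=
  {z | ∃ g : Cp K, ∀ f : K, f.1.extend z = g.1 f}

theorem range_subset_finiteContinuousLocus (K : Set (Cp X)) :
    range (stoneCechUnit : X → StoneCech X) ⊆ finiteContinuousLocus K := by
  rintro _ ⟨x, rfl⟩
  exact ⟨⟨fun f => f.1.1 x, (Cp.continuous_eval x).comp continuous_subtype_val⟩,
    fun f => f.1.extend_unit x⟩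

/-- The locus is the graph of `g`, cut out of `βX × Cp K` by closed equations; both factors are
κ-spaces because `βX` and `K` are compact. -/
theorem isKappaSpace_finiteContinuousLocus {K : Set (Cp X)} (hK : IsCompact K) :
    IsKappaSpace (finiteContinuousLocus K) := by
  have : CompactSpace K := isCompact_iff_compactSpace.1 hK
  choose g hg using fun z : finiteContinuousLocus K => z.2
  have hgc : Continuous g := by
    rw [Cp.continuous_iff]
    intro f
    rw [EReal.isEmbedding_coe.isInducing.continuous_iff]
    exact (f.1.continuous_extend.comp continuous_subtype_val).congr fun z => hg z f
  refine ((isKappaSpace_of_compactSpace (StoneCech X)).prod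
    (isKappaSpace_Cp K)).of_isClosedEmbedding (f := fun z => (z.1, g z)) ⟨?_, ?_⟩
  · exact .of_comp (continuous_subtype_val.prodMk hgc) continuous_fst .subtypeVal
  · have : range (fun z : finiteContinuousLocus K => (z.1, g z)) =
        ⋂ f : K, {p : StoneCech X × Cp K | f.1.extend p.1 = p.2.1 f} := by
      ext ⟨z, k⟩
      simp only [mem_range, mem_iInter, mem_ofPred_eq, Prod.mk.injEq]
      constructor
      · rintro ⟨w, rfl, rfl⟩ f
        exact hg w f
      · intro h
        refine ⟨⟨z, k, h⟩, rfl, ?_⟩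
        apply Subtype.ext
        funext f
        exact EReal.coe_injective ((hg ⟨z, k, h⟩ f).symm.trans (h f))
    rw [this]
    exact isClosed_iInter fun f => isClosed_eq
      (f.1.continuous_extend.comp continuous_fst)
      (continuous_coe_real_ereal.comp ((Cp.continuous_eval f).comp continuous_snd))

theorem kappaCompletion_subset_finiteContinuousLocus {K : Set (Cp X)} (hK : IsCompact K) :
    kappaCompletion X ⊆ finiteContinuousLocus K :=
  sInter_subset_of_mem
    ⟨range_subset_finiteContinuousLocus K, isKappaSpace_finiteContinuousLocus hK⟩

theorem range_subset_kappaCompletion :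
    range (stoneCechUnit : X → StoneCech X) ⊆ kappaCompletion X :=
  subset_sInter fun _ hZ => hZ.1

variable {Y : Set (StoneCech X)} (hY : range (stoneCechUnit : X → StoneCech X) ⊆ Y)

theorem Cp.continuous_restrict : Continuous (Cp.restrict hY) := by
  rw [Cp.continuous_iff]
  exact fun x => Cp.continuous_eval _

theorem Cpb.continuous_restrict : Continuous (Cpb.restrict hY) := by
  rw [continuous_induced_rng]
  exact (Cp.continuous_restrict hY).comp continuous_subtype_val

theorem denseRange_unit_codRestrict :
    DenseRange fun x : X => (⟨stoneCechUnit x, hY (mem_range_self x)⟩ : Y) := by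
  intro y
  rw [closure_subtype, ← range_comp]
  exact denseRange_stoneCechUnit y.1

theorem Cp.restrict_injective : Function.Injective (Cp.restrict hY) := by
  intro f g hfg
  apply Subtype.ext
  exact (denseRange_unit_codRestrict hY).equalizer f.2 g.2
    (congrArg Subtype.val hfg)

theorem Cpb.restrict_injective : Function.Injective (Cpb.restrict hY) := fun _ _ hfg =>
  Subtype.ext (Cp.restrict_injective hY (congrArg Subtype.val hfg))

theorem Cp.bounded_of_restrict (f : Cp Y)
    (hf : ∃ M : ℝ, ∀ x, |(Cp.restrict hY f).1 x| ≤ M) : ∃ M : ℝ, ∀ y, |f.1 y| ≤ M := by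
  obtain ⟨M, hM⟩ := hf
  exact ⟨M, fun y => (denseRange_unit_codRestrict hY).induction_on y
    (isClosed_le (continuous_abs.comp f.2) continuous_const) hM⟩

theorem sameCompactSubsets_restrict_of_subset_kappaCompletion (hκ : Y ⊆ kappaCompletion X) :
    SameCompactSubsets (Cp.restrict hY) := by
  refine .of_sections (Cp.continuous_restrict hY) (Cp.restrict_injective hY) fun K hK => ?_
  choose g hg using fun y : Y =>
    kappaCompletion_subset_finiteContinuousLocus hK (hκ y.2)
  refine ⟨fun f => ⟨fun y => (g y).1 f, ?_⟩, ?_, ?_⟩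
  · rw [EReal.isEmbedding_coe.isInducing.continuous_iff]
    exact (f.1.continuous_extend.comp continuous_subtype_val).congr fun y => hg y f
  · rw [Cp.continuous_iff]
    exact fun y => (g y).2
  · intro f
    apply Subtype.ext
    funext x
    exact EReal.coe_injective ((hg ⟨_, hY (mem_range_self x)⟩ f).symm.trans (f.1.extend_unit x))

theorem SameCompactSubsets.restrict_bounded (h : SameCompactSubsets (Cp.restrict hY)) :
    SameCompactSubsets (Cpb.restrict hY) := by
  refine .of_sections (Cpb.continuous_restrict hY) (Cpb.restrict_injective hY) fun K hK => ?_
  have : CompactSpace K := isCompact_iff_compactSpace.1 hK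
  obtain ⟨s, hsc, hs⟩ := h.exists_lift (Cp.continuous_restrict hY) (G := fun f : K => f.1.1)
    (continuous_subtype_val.comp continuous_subtype_val)
  refine ⟨fun f => ⟨s f, Cp.bounded_of_restrict hY _ ?_⟩, hsc.subtype_mk _,
    fun f => Subtype.ext (hs f)⟩
  rw [hs]
  exact f.1.2

/-- The trace on `X` of the neighbourhoods of a point of `βX`. -/
def traceNhds (y : StoneCech X) : Filter X := comap stoneCechUnit (𝓝 y)

instance traceNhds_neBot (y : StoneCech X) : (traceNhds y).NeBot :=
  comap_neBot fun t ht => by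
    obtain ⟨_, hx, x, rfl⟩ := mem_closure_iff_nhds.1 (denseRange_stoneCechUnit y) t ht
    exact ⟨x, hx⟩

theorem Cp.tendsto_restrict (f : Cp Y) (y : Y) :
    Tendsto (Cp.restrict hY f).1 (traceNhds y.1) (𝓝 (f.1 y)) := by
  refine (f.2.tendsto y).comp ?_
  rw [tendsto_subtype_rng]
  exact tendsto_comap

/-- A pointwise continuous and uniformly bounded family of functions on `X` over a compact space
has limits at the points of `Y` that depend continuously on the parameter. -/
theorem SameCompactSubsets.exists_continuous_limit (h : SameCompactSubsets (Cpb.restrict hY))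
    {T : Type*} [TopologicalSpace T] [CompactSpace T] (G : T → X → ℝ)
    (hX : ∀ t, Continuous (G t)) (hT : ∀ x, Continuous fun t => G t x)
    (hb : ∀ t, ∃ M, ∀ x, |G t x| ≤ M) (y : Y) :
    ∃ v : T → ℝ, Continuous v ∧ ∀ t, Tendsto (G t) (traceNhds y.1) (𝓝 (v t)) := by
  obtain ⟨s, hsc, hs⟩ := h.exists_lift (Cpb.continuous_restrict hY)
    (G := fun t => (⟨⟨G t, hX t⟩, hb t⟩ : Cpb X))
    ((Cp.continuous_iff.2 hT).subtype_mk _)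
  refine ⟨fun t => (s t).1.1 y, (Cp.continuous_eval y).comp (continuous_subtype_val.comp hsc),
    fun t => ?_⟩
  have := Cp.tendsto_restrict hY (s t).1 y
  rwa [show Cp.restrict hY (s t).1 = ⟨G t, hX t⟩ from congrArg Subtype.val (hs t)] at this

/-- If `|f| → ∞`, the limits of `exp (-t|f|)` would be 1 at `t = 0` and 0 for `t > 0`, which is not
continuous in `t`. -/
theorem SameCompactSubsets.not_tendsto_abs_atTop (h : SameCompactSubsets (Cpb.restrict hY))
    (f : Cp X) (y : Y) : ¬ Tendsto (fun x => |f.1 x|) (traceNhds y.1) atTop := by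
  intro hf
  obtain ⟨v, hv, hlim⟩ := h.exists_continuous_limit hY (T := Icc (0 : ℝ) 1)
    (fun t x => Real.exp (-(t.1 * |f.1 x|)))
    (fun t => by have := f.2; fun_prop) (fun x => by fun_prop)
    (fun t => ⟨1, fun x => by
      rw [abs_of_pos (Real.exp_pos _), Real.exp_le_one_iff, neg_nonpos]
      exact mul_nonneg t.2.1 (abs_nonneg _)⟩) y
  have h0 : v 0 = 1 := tendsto_nhds_unique (hlim 0) (by simp)
  have hpos : ∀ t : Icc (0 : ℝ) 1, 0 < t.1 → v t = 0 := fun t ht =>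
    tendsto_nhds_unique (hlim t)
      (Real.tendsto_exp_neg_atTop_nhds_zero.comp (hf.const_mul_atTop ht))
  let u : ℕ → Icc (0 : ℝ) 1 := fun n =>
    ⟨1 / ((n : ℝ) + 1), by positivity, by
      rw [div_le_one (by positivity)]
      linarith [(Nat.cast_nonneg n : (0 : ℝ) ≤ n)]⟩
  have hu : Tendsto u atTop (𝓝 0) := by
    rw [tendsto_subtype_rng]
    exact tendsto_one_div_add_atTop_nhds_zero_nat
  have hvu := (hv.tendsto 0).comp hu
  have hzero : v ∘ u = fun _ => 0 := funext fun n => hpos _ Nat.one_div_pos_of_nat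
  rw [h0, hzero] at hvu
  exact zero_ne_one (tendsto_nhds_unique tendsto_const_nhds hvu)

theorem SameCompactSubsets.exists_limit (h : SameCompactSubsets (Cpb.restrict hY))
    (f : Cp X) (y : Y) : ∃ v : ℝ, Tendsto f.1 (traceNhds y.1) (𝓝 v) := by
  have hlim : Tendsto (fun x => (f.1 x : EReal)) (traceNhds y.1) (𝓝 (f.extend y.1)) :=
    ((f.continuous_extend.tendsto y.1).comp tendsto_comap).congr f.extend_unit
  have hfin := h.not_tendsto_abs_atTop hY f y
  generalize f.extend y.1 = w at hlim
  induction w using EReal.rec with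
  | bot => exact absurd (tendsto_abs_atBot_atTop.comp (EReal.tendsto_coe_nhds_bot_iff.1 hlim)) hfin
  | coe v => exact ⟨v, EReal.tendsto_coe.1 hlim⟩
  | top => exact absurd (tendsto_abs_atTop_atTop.comp (EReal.tendsto_coe_nhds_top_iff.1 hlim)) hfin

theorem SameCompactSubsets.subset_of_isKappaSpace (h : SameCompactSubsets (Cpb.restrict hY))
    {Z : Set (StoneCech X)} (hXZ : range (stoneCechUnit : X → StoneCech X) ⊆ Z)
    (hZ : IsKappaSpace Z) : Y ⊆ Z := by
  intro y hy
  obtain ⟨L, _, _, _, φ, hφ⟩ := hZ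
  let ι : X → Z := fun x => ⟨stoneCechUnit x, hXZ (mem_range_self x)⟩
  have hι : Continuous ι := continuous_stoneCechUnit.subtype_mk _
  let F : L → Cp X := fun l =>
    ⟨fun x => (φ (ι x)).1 l, (Cp.continuous_eval l).comp (hφ.continuous.comp hι)⟩
  choose ψ hψ using fun l => h.exists_limit hY (F l) ⟨y, hy⟩
  have hψc : Continuous ψ := by
    rw [continuous_iff_continuousAt]
    intro l
    obtain ⟨K, hK, hKl⟩ := exists_compact_mem_nhds l
    have : CompactSpace K := isCompact_iff_compactSpace.1 hK
    -- Only bounded families lift, hence `arctan`; the parameter runs over a compact neighbourhood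
    -- of `l`.
    obtain ⟨v, hv, hlim⟩ := h.exists_continuous_limit hY
      (fun (k : K) x => Real.arctan ((F k).1 x))
      (fun k => Real.continuous_arctan.comp (F k).2)
      (fun x => Real.continuous_arctan.comp ((φ (ι x)).2.comp continuous_subtype_val))
      (fun k => ⟨Real.pi / 2, fun x => abs_le.2
        ⟨(Real.neg_pi_div_two_lt_arctan _).le, (Real.arctan_lt_pi_div_two _).le⟩⟩) ⟨y, hy⟩
    -- Since `ψ k` is finite, `v k` stays inside `(-π/2, π/2)`, where `tan` undoes `arctan`
    -- continuously.
    have hvψ : ∀ k : K, Real.tan (v k) = ψ k ∧ ContinuousAt Real.tan (v k) := fun k => by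
      have : v k = Real.arctan (ψ k) := tendsto_nhds_unique (hlim k)
        ((Real.continuous_arctan.tendsto _).comp (hψ k))
      rw [this, Real.tan_arctan, Real.continuousAt_tan]
      exact ⟨rfl, (Real.cos_arctan_pos _).ne'⟩
    have hK' : ContinuousOn ψ K := by
      rw [continuousOn_iff_continuous_domRestrict, continuous_iff_continuousAt]
      intro k
      exact ((hvψ k).2.comp hv.continuousAt).congr (.of_forall fun k => (hvψ k).1)
    exact hK'.continuousAt hKl
  have htend : Tendsto (fun x => φ (ι x)) (traceNhds y) (𝓝 ⟨ψ, hψc⟩) :=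
    Cp.tendsto_iff.2 hψ
  obtain ⟨z, hz⟩ := hφ.isClosed_range.mem_of_tendsto htend
    (.of_forall fun x => mem_range_self _)
  rw [← hz] at htend
  have hιz : Tendsto ι (traceNhds y) (𝓝 z) := hφ.isInducing.tendsto_nhds_iff.2 htend
  -- `traceNhds y` converges in `βX` both to `y` and to the point `z` of `Z`.
  have hyz : y = z := tendsto_nhds_unique (l := traceNhds y) tendsto_comap
    ((continuous_subtype_val.tendsto z).comp hιz)
  exact hyz ▸ z.2

theorem SameCompactSubsets.subset_kappaCompletion (h : SameCompactSubsets (Cpb.restrict hY)) :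
    Y ⊆ kappaCompletion X :=
  subset_sInter fun _ hZ => h.subset_of_isKappaSpace hY hZ.1 hZ.2

end Completion

theorem theoremt (X : Type u) [TopologicalSpace X] [T35Space X] :
    (∀ (Y : Set (StoneCech X)) (hY : range (stoneCechUnit : X → StoneCech X) ⊆ Y),
      List.TFAE [
        SameCompactSubsets (Cp.restrict hY),
        SameCompactSubsets (Cpb.restrict hY),
        Y ⊆ kappaCompletion X]) ∧
    IsGreatest
      {Y : Set (StoneCech X) | ∃ hY : range (stoneCechUnit : X → StoneCech X) ⊆ Y,
        SameCompactSubsets (Cp.restrict hY)}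
      (kappaCompletion X) := by
  refine ⟨fun Y hY => ?_, ?_, ?_⟩
  · tfae_have 1 → 2 := fun h => h.restrict_bounded hY
    tfae_have 2 → 3 := fun h => h.subset_kappaCompletion hY
    tfae_have 3 → 1 := fun h => sameCompactSubsets_restrict_of_subset_kappaCompletion hY h
    tfae_finish
  · exact ⟨range_subset_kappaCompletion,
      sameCompactSubsets_restrict_of_subset_kappaCompletion _ Subset.rfl⟩
  · rintro Y ⟨hY, h⟩
    exact (h.restrict_bounded hY).subset_kappaCompletion hY
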